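/- Let $V$ be a finite-dimensional Euclidean space with inner product $(\cdot,\cdot)$, let $\Phi\subset V$ be a reduced, irreducible (crystallographic) root system spanning $V$, with Weyl group $W\subset \mathrm{O}(V)$ generated by the orthogonal reflections in the hyperplanes perpendicular to the roots. Let $\Pi=\{\alpha_i : i\in I\}$ be a system of simple roots, let $\alpha_0=\sum_{i\in I} m_i\alpha_i$ be the highest root, and call $\alpha_j$ ($j \in I$) minuscule if $m_j=1$. Let $\varpi_j^\vee\in V$ be the fundamental coweights, $(\varpi_j^\vee,\alpha_i)=\delta_{ij}$, let $P^\vee=\{x\in V : (x,\alpha)\in\mathbb Z \text{ for all } \alpha\in\Phi\}$ be the coweight lattice, and write $t_\gamma$ for the translation by $\gamma$. Let $W_{\mathrm{ext}}=P^\vee\rtimes W=\{t_\gamma w : \gamma\in P^\vee,\ w\in W\}$ be the extended affine Weyl group. Let $$\mathcal A=\{x\in V : (\alpha_i,x)\ge 0 \text{ for all } i\in I,\ (\alpha_0,x)\le 1\}$$ be the fundamental alcove with respect to $\Pi$ (the fundamental alcove with respect to another system of simple roots is defined in the same way from its simple roots and its highest root), and let $\Omega=\{\zeta\in W_{\mathrm{ext}}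 : \zeta(\mathcal A)=\mathcal A\}$ be the fundamental group. For each minuscule $\alpha_j$, the set $\Pi_j=\{-\alpha_0\}\cup\{\alpha_i : i\ne j\}$ is a system of simple roots of $\Phi$, and there is a unique $v_j\in W$ with $v_j\Pi=\Pi_j$. Moreover: 1. For each minuscule $\alpha_j$, the fundamental alcove with respect to $\Pi_j$ is $v_j\mathcal A=\mathcal A-\varpi_j^\vee$. 2. $\Omega=\{1\}\cup\{t_{\varpi_j^\vee}v_j : \alpha_j \text{ minuscule}\}$. 3. $\mathcal A\cap P^\vee=\{0\}\cup\{\varpi_j^\vee : \alpha_j\text{ minuscule}\}$ (the minuscule vertices of $\mathcal A$), and $\Omega$ maps this set to itself and acts simply transitively on it. -/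

import Mathlib

open scoped RealInnerProductSpace

noncomputable section

namespace RootPairing

/-- A root pairing of a Euclidean space `V` with itself is Euclidean if the pairing is the inner
product and every coroot is `α^∨ = 2 α / (α, α)`. Equivalently, the reflection attached to every
root is the orthogonal reflection, as for a classical root system in a Euclidean space. -/
class IsEuclidean {ι V : Type*} [NormedAddCommGroup V] [InnerProductSpace ℝ V]
    (P : RootPairing ι ℝ V V) : Prop where
  toLinearMap_apply : ∀ x y : V, P.toLinearMap x y = ⟪x, y⟫
  coroot_eq : ∀ i, P.coroot i = (2 / ⟪P.root i, P.root i⟫) • P.root i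

section Euclidean

variable {ι V : Type*} [NormedAddCommGroup V] [InnerProductSpace ℝ V] (P : RootPairing ι ℝ V V)

/-- The Weyl group `W`, as a subgroup of the orthogonal group of `V`: it is generated by the
orthogonal reflections in the hyperplanes perpendicular to the roots. -/
def orthogonalWeylGroup : Subgroup (V ≃ₗᵢ[ℝ] V) :=
  Subgroup.closure (Set.range fun i => (ℝ ∙ P.root i)ᗮ.reflection)

/-- The coweight lattice `P^∨`: the vectors that have integral inner product with all roots. -/
def coweightLattice : AddSubgroup V where
  carrier := {x | ∀ i, ∃ n : ℤ, ⟪P.root i, x⟫ = n}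
  zero_mem' := fun i => ⟨0, by simp⟩
  add_mem' := by
    intro x y hx hy i
    obtain ⟨m, hm⟩ := hx i
    obtain ⟨n, hn⟩ := hy i
    exact ⟨m + n, by rw [inner_add_right, hm, hn]; push_cast; ring⟩
  neg_mem' := by
    intro x hx i
    obtain ⟨m, hm⟩ := hx i
    exact ⟨-m, by rw [inner_neg_right, hm]; push_cast; ring⟩

theorem orthogonal_reflection_root [P.IsEuclidean] (i j : ι) :
    (ℝ ∙ P.root i)ᗮ.reflection (P.root j) = P.root (P.reflectionPerm i j) := by
  have h : (2 : ℕ) • (⟪P.root j, P.root i⟫ / ‖P.root i‖ ^ 2) • P.root i =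
      (2 / ‖P.root i‖ ^ 2 * ⟪P.root j, P.root i⟫) • P.root i := by
    rw [two_nsmul, ← add_smul]
    congr 1
    ring
  rw [Submodule.reflection_orthogonal_apply, Submodule.reflection_singleton_apply,
    ← P.reflectionPerm_root, IsEuclidean.toLinearMap_apply, IsEuclidean.coroot_eq,
    inner_smul_right, real_inner_self_eq_norm_sq, real_inner_comm, neg_sub]
  simp only [RCLike.ofReal_real_eq_id, id_eq]
  rw [h]

theorem inner_reflection_right (i j : ι) (x : V) [P.IsEuclidean] :
    ⟪P.root j, (ℝ ∙ P.root i)ᗮ.reflection x⟫ = ⟪P.root (P.reflectionPerm i j), x⟫ := by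
  rw [← P.orthogonal_reflection_root i j,
    ← LinearIsometryEquiv.inner_map_map (ℝ ∙ P.root i)ᗮ.reflection,
    Submodule.reflection_reflection]

/-- The coweight lattice is invariant under the Weyl group. -/
theorem orthogonalWeylGroup_apply_mem_coweightLattice [P.IsEuclidean] {w : V ≃ₗᵢ[ℝ] V}
    (hw : w ∈ P.orthogonalWeylGroup) :
    ∀ x : V, x ∈ P.coweightLattice → w x ∈ P.coweightLattice := by
  have key : ∀ i {x : V}, x ∈ P.coweightLattice →
      (ℝ ∙ P.root i)ᗮ.reflection x ∈ P.coweightLattice := by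
    intro i x hx j
    obtain ⟨n, hn⟩ := hx (P.reflectionPerm i j)
    exact ⟨n, by rw [P.inner_reflection_right, hn]⟩
  refine Subgroup.closure_induction_left (p := fun w _ => ∀ x : V, x ∈ P.coweightLattice →
    w x ∈ P.coweightLattice) ?_ ?_ ?_ hw
  · intro x hx
    exact hx
  · rintro _ ⟨i, rfl⟩ y _ ih x hx
    exact key i (ih x hx)
  · rintro _ ⟨i, rfl⟩ y _ ih x hx
    rw [Submodule.reflection_inv]
    exact key i (ih x hx)

/-- The extended affine Weyl group `W_ext = P^∨ ⋊ W`, as a group of affine isometries of `V`: it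
consists of the maps `t_γ w : x ↦ w x + γ` with `γ ∈ P^∨` and `w ∈ W`. -/
def extendedAffineWeylGroup [P.IsEuclidean] : Subgroup (V ≃ᵃⁱ[ℝ] V) where
  carrier := {ζ | ∃ γ ∈ P.coweightLattice, ∃ w ∈ P.orthogonalWeylGroup,
    ζ = AffineIsometryEquiv.constVAdd ℝ V γ * w.toAffineIsometryEquiv}
  one_mem' := ⟨0, zero_mem _, 1, one_mem _, by ext x; simp⟩
  mul_mem' := by
    rintro _ _ ⟨γ, hγ, w, hw, rfl⟩ ⟨δ, hδ, u, hu, rfl⟩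
    refine ⟨γ + w δ, add_mem hγ (P.orthogonalWeylGroup_apply_mem_coweightLattice hw _ hδ),
      w * u, mul_mem hw hu, ?_⟩
    ext x
    simp [add_assoc]
  inv_mem' := by
    rintro _ ⟨γ, hγ, w, hw, rfl⟩
    refine ⟨-(w⁻¹ γ), neg_mem (P.orthogonalWeylGroup_apply_mem_coweightLattice (inv_mem hw) _ hγ),
      w⁻¹, inv_mem hw, ?_⟩
    rw [inv_eq_iff_mul_eq_one]
    ext x
    simp

end Euclidean

theorem nonempty_of_isIrreducible {ι V : Type*} [AddCommGroup V] [Module ℝ V]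
    (P : RootPairing ι ℝ V V) [P.IsRootSystem] [P.IsIrreducible] : Nonempty ι := by
  by_contra h
  rw [not_nonempty_iff] at h
  have h1 := IsRootSystem.span_root_eq_top (P := P)
  rw [Set.range_eq_empty, Submodule.span_empty] at h1
  have := IsIrreducible.nontrivial P
  exact bot_ne_top h1

namespace Base

section Basic

variable {ι V : Type*} [NormedAddCommGroup V] [InnerProductSpace ℝ V] {P : RootPairing ι ℝ V V}

/-- The system of simple roots `Π`, as a set of vectors. -/
def simpleRoots (b : P.Base) : Set V := P.root '' b.support

variable [P.IsRootSystem] (b : P.Base)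

/-- The fundamental coweights `ϖ_j^∨`: the basis of `V` dual to the simple roots; see
`inner_root_fundamentalCoweight`. -/
def fundamentalCoweight (j : b.support) : V :=
  P.toLinearMap.flip.toPerfPair.symm (b.toWeightBasis.coord j)

open Classical in
theorem inner_root_fundamentalCoweight [P.IsEuclidean] (i j : b.support) :
    ⟪P.root i, b.fundamentalCoweight j⟫ = if i = j then 1 else 0 := by
  rw [← IsEuclidean.toLinearMap_apply (P := P), fundamentalCoweight,
    LinearMap.apply_toPerfPair_flip, Module.Basis.coord_apply, toWeightBasis_repr_root,
    Finsupp.single_apply]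

end Basic

section Irreducible

variable {ι V : Type*} [Finite ι] [NormedAddCommGroup V] [InnerProductSpace ℝ V]
  {P : RootPairing ι ℝ V V} [P.IsRootSystem] [P.IsIrreducible] (b : P.Base)

/-- The index of the highest root `α₀`, i.e. of the root of greatest height. -/
def highestRootIdx : ι :=
  haveI := P.nonempty_of_isIrreducible
  (Finite.exists_max b.height).choose

theorem height_le_height_highestRootIdx (i : ι) : b.height i ≤ b.height b.highestRootIdx :=
  haveI := P.nonempty_of_isIrreducible
  (Finite.exists_max b.height).choose_spec i

/-- The highest root `α₀`. -/
def highestRoot : V := P.root b.highestRootIdx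

/-- The simple root `α_j` is minuscule if the coefficient `m_j` of `α_j` in the expansion
`α₀ = ∑ mᵢ αᵢ` of the highest root in simple roots is `1`. -/
def IsMinuscule (j : b.support) : Prop := b.toWeightBasis.repr b.highestRoot j = 1

/-- The fundamental alcove `𝓐` of the system of simple roots `b`. -/
def alcove : Set V := {x | (∀ i ∈ b.support, 0 ≤ ⟪P.root i, x⟫) ∧ ⟪b.highestRoot, x⟫ ≤ 1}

/-- The set `Π_j = {-α₀} ∪ {αᵢ : i ≠ j}`. -/
def exchangedRoots (j : b.support) : Set V :=
  insert (-b.highestRoot) ((fun i : b.support => P.root i) '' {i | i ≠ j})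

/-- The fundamental group `Ω`: the stabilizer of the fundamental alcove `𝓐` in the extended affine
Weyl group. -/
def fundamentalGroup [P.IsEuclidean] : Subgroup (V ≃ᵃⁱ[ℝ] V) where
  carrier := {ζ | ζ ∈ P.extendedAffineWeylGroup ∧ ζ '' b.alcove = b.alcove}
  one_mem' := ⟨one_mem _, by simp⟩
  mul_mem' := by
    rintro ζ η ⟨hζ, hζ'⟩ ⟨hη, hη'⟩
    exact ⟨mul_mem hζ hη, by rw [AffineIsometryEquiv.coe_mul, Set.image_comp, hη', hζ']⟩
  inv_mem' := by
    rintro ζ ⟨hζ, hζ'⟩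
    refine ⟨inv_mem hζ, ?_⟩
    conv_lhs => rw [← hζ']
    rw [← Set.image_comp, ← AffineIsometryEquiv.coe_mul, inv_mul_cancel]
    simp

end Irreducible

end Base

end RootPairing

end

/-!
The Weyl group `W` acts freely on systems of simple roots: a nontrivial product of simple
reflections of minimal length sends its last letter to a negative root, by the exchange condition
(`eq_one_of_forall_isPos`). Since the simple roots can be recovered from the alcove, an element of
`W` that preserves the alcove is trivial as well (`eq_one_of_image_alcove_eq`). Hence an element of
`Ω` is determined by the image of the vertex `0`, which is a coweight in the alcove.

The coefficients of any root are at most those of the highest root, and the latter are all positive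
(`simpleCoeff_le_simpleCoeff_highestRootIdx`, `simpleCoeff_highestRootIdx_pos`). It follows that the
nonzero coweights in the alcove are the `ϖ_j^∨` with `α_j` minuscule
(`alcove_inter_coweightLattice`), and that the alcove is cut out by the inequalities `(α, x) ≥ 0`
for `α` simple and `(β, x) ≤ 1` for all roots `β`, so that it depends only on the set of simple
roots (`mem_alcove_iff`).

It remains to reach `ϖ_j^∨` from `0`. For `α_j` minuscule the vector
`y = ρ^∨ - (ht α₀ + 1) ϖ_j^∨` has nonzero integral inner product with every root, and inner product
`1` with the elements of `Π_j`. If `w ∈ W` makes `y` dominant, then `(α, w y) ≥ 1` for all simple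
`α`, so a root `β` with `(β, w y) = 1` has height one. Therefore `w Π_j ⊆ Π`, with equality by
counting, and `v_j = w⁻¹` (`exists_image_simpleRoots_eq_exchangedRoots`). Comparing inequalities
gives `v_j 𝓐 = 𝓐 - ϖ_j^∨` (`image_alcove_eq_image_sub_fundamentalCoweight`), so `t_{ϖ_j^∨} v_j`
lies in `Ω` and sends `0` to `ϖ_j^∨`.
-/

/-! ### Roots in terms of simple roots -/

namespace RootPairing

section Pairing

variable {ι V : Type*} [NormedAddCommGroup V] [InnerProductSpace ℝ V]
  (P : RootPairing ι ℝ V V) [P.IsEuclidean]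

omit [P.IsEuclidean] in
theorem inner_root_self_pos (i : ι) : 0 < ⟪P.root i, P.root i⟫ :=
  real_inner_self_pos.mpr (P.ne_zero i)

theorem pairing_eq_inner (i j : ι) :
    P.pairing i j = 2 / ⟪P.root j, P.root j⟫ * ⟪P.root i, P.root j⟫ := by
  rw [← P.root_coroot_eq_pairing, IsEuclidean.toLinearMap_apply, IsEuclidean.coroot_eq,
    inner_smul_right]

variable [P.IsCrystallographic]

theorem pairingIn_pos_iff_inner_pos (i j : ι) :
    0 < P.pairingIn ℤ i j ↔ 0 < ⟪P.root i, P.root j⟫ := by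
  have h : ((P.pairingIn ℤ i j : ℤ) : ℝ) = P.pairing i j := P.algebraMap_pairingIn ℤ i j
  rw [← Int.cast_pos (R := ℝ), h, pairing_eq_inner]
  exact mul_pos_iff_of_pos_left (div_pos two_pos (P.inner_root_self_pos j))

theorem pairingIn_neg_iff_inner_neg (i j : ι) :
    P.pairingIn ℤ i j < 0 ↔ ⟪P.root i, P.root j⟫ < 0 := by
  have h : ((P.pairingIn ℤ i j : ℤ) : ℝ) = P.pairing i j := P.algebraMap_pairingIn ℤ i j
  rw [← Int.cast_lt_zero (R := ℝ), h, pairing_eq_inner]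
  exact smul_neg_iff_of_pos_left (div_pos two_pos (P.inner_root_self_pos j))

end Pairing

namespace Base

section Coeff

variable {ι V : Type*} [NormedAddCommGroup V] [InnerProductSpace ℝ V]
  {P : RootPairing ι ℝ V V} (b : P.Base)

theorem exists_root_eq_sum_support (i : ι) :
    ∃ c : b.support → ℤ, P.root i = ∑ j, c j • P.root j := by
  obtain ⟨f, -, -, hf⟩ := b.exists_root_eq_sum_int i
  refine ⟨fun j => f j, ?_⟩
  rw [hf, ← Finset.sum_coe_sort b.support (fun j => f j • P.root j)]

/-- The integral coefficients of a root in the basis of simple roots. -/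
noncomputable def simpleCoeff (i : ι) : b.support → ℤ :=
  (b.exists_root_eq_sum_support i).choose

theorem root_eq_sum_simpleCoeff (i : ι) : P.root i = ∑ j, b.simpleCoeff i j • P.root j :=
  (b.exists_root_eq_sum_support i).choose_spec

theorem simpleCoeff_unique {i : ι} {c : b.support → ℤ} (h : P.root i = ∑ j, c j • P.root j) :
    b.simpleCoeff i = c := by
  funext j
  exact Fintype.linearIndependent_iffₛ.mp (b.linearIndepOn_root.restrict_scalars' ℤ) _ _
    ((b.root_eq_sum_simpleCoeff i).symm.trans h) j

theorem inner_root_eq_sum_simpleCoeff (i : ι) (x : V) :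
    ⟪P.root i, x⟫ = ∑ j, (b.simpleCoeff i j : ℝ) * ⟪P.root j, x⟫ := by
  conv_lhs => rw [b.root_eq_sum_simpleCoeff i]
  rw [sum_inner]
  refine Finset.sum_congr rfl fun j _ => ?_
  rw [← Int.cast_smul_eq_zsmul ℝ, real_inner_smul_left]

theorem height_eq_sum_simpleCoeff (i : ι) : b.height i = ∑ j, b.simpleCoeff i j := by
  classical
  let f : ι → ℤ := fun j => if h : j ∈ b.support then b.simpleCoeff i ⟨j, h⟩ else 0
  have hf : ∀ j : b.support, f j = b.simpleCoeff i j := fun j => by simp [f]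
  have h : P.root i = ∑ j ∈ b.support, f j • P.root j := by
    rw [b.root_eq_sum_simpleCoeff i, ← Finset.sum_coe_sort b.support]
    exact Finset.sum_congr rfl fun j _ => by rw [hf]
  rw [height_eq_sum h, ← Finset.sum_coe_sort b.support]
  exact Finset.sum_congr rfl fun j _ => hf j

theorem simpleCoeff_nonneg_or_nonpos (i : ι) :
    (∀ j, 0 ≤ b.simpleCoeff i j) ∨ ∀ j, b.simpleCoeff i j ≤ 0 := by
  obtain ⟨f, -, hpos, hf⟩ := b.exists_root_eq_sum_int i
  have h : b.simpleCoeff i = fun j : b.support => f j :=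
    b.simpleCoeff_unique <| by rw [hf, ← Finset.sum_coe_sort b.support (fun j => f j • P.root j)]
  rw [h]
  exact hpos.imp (fun h j => h.le j) (fun h j => h.le j)

variable {b}

theorem IsPos.simpleCoeff_nonneg {i : ι} (hi : b.IsPos i) (j : b.support) :
    0 ≤ b.simpleCoeff i j := by
  refine (b.simpleCoeff_nonneg_or_nonpos i).elim (fun h => h j) fun h => ?_
  rw [isPos_iff, height_eq_sum_simpleCoeff] at hi
  exact absurd hi (Finset.sum_nonpos fun j _ => h j).not_gt

theorem simpleCoeff_nonpos_of_not_isPos {i : ι} (hi : ¬ b.IsPos i) (j : b.support) :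
    b.simpleCoeff i j ≤ 0 := by
  refine (b.simpleCoeff_nonneg_or_nonpos i).elim (fun h => ?_) fun h => h j
  rw [isPos_iff', height_eq_sum_simpleCoeff] at hi
  exact absurd (Finset.sum_nonneg fun j _ => h j) hi

variable (b)

theorem simpleCoeff_sub {i j k : ι} (h : P.root k = P.root i - P.root j) :
    b.simpleCoeff k = b.simpleCoeff i - b.simpleCoeff j := by
  refine b.simpleCoeff_unique ?_
  rw [h, b.root_eq_sum_simpleCoeff i, b.root_eq_sum_simpleCoeff j, ← Finset.sum_sub_distrib]
  exact Finset.sum_congr rfl fun l _ => by rw [Pi.sub_apply, sub_smul]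

theorem simpleCoeff_add {i j k : ι} (h : P.root k = P.root i + P.root j) :
    b.simpleCoeff k = b.simpleCoeff i + b.simpleCoeff j := by
  refine b.simpleCoeff_unique ?_
  rw [h, b.root_eq_sum_simpleCoeff i, b.root_eq_sum_simpleCoeff j, ← Finset.sum_add_distrib]
  exact Finset.sum_congr rfl fun l _ => by rw [Pi.add_apply, add_smul]

open Classical in
theorem simpleCoeff_simple (i : b.support) : b.simpleCoeff i = Pi.single i 1 := by
  refine b.simpleCoeff_unique ?_
  rw [Finset.sum_eq_single i (fun j _ hj => by rw [Pi.single_eq_of_ne hj, zero_smul])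
    (fun h => absurd (Finset.mem_univ i) h), Pi.single_eq_same, one_smul]

variable {b} in
theorem IsPos.mem_support_of_height_le_one {i : ι} (hi : b.IsPos i) (h : b.height i ≤ 1) :
    i ∈ b.support := by
  classical
  obtain ⟨j, -, hj⟩ : ∃ j ∈ Finset.univ, 0 < b.simpleCoeff i j := by
    refine Finset.exists_lt_of_sum_lt (f := 0) ?_
    rw [← height_eq_sum_simpleCoeff]
    simpa using b.isPos_iff.mp hi
  have hsum := height_eq_sum_simpleCoeff b i
  rw [← Finset.add_sum_erase _ _ (Finset.mem_univ j)] at hsum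
  have hnn : ∀ k ∈ Finset.univ.erase j, 0 ≤ b.simpleCoeff i k := fun k _ => hi.simpleCoeff_nonneg k
  have hrest := Finset.sum_nonneg hnn
  have h0 := (Finset.sum_eq_zero_iff_of_nonneg hnn).mp (by omega)
  have h1 : b.simpleCoeff i j = 1 := by omega
  have : P.root i = P.root j := by
    rw [b.root_eq_sum_simpleCoeff i, Finset.sum_eq_single j (fun k _ hk => by
      rw [h0 k (Finset.mem_erase.mpr ⟨hk, Finset.mem_univ k⟩), zero_smul])
      (fun h => absurd (Finset.mem_univ j) h), h1, one_smul]
  rw [P.root.injective this]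
  exact j.2

section RootSystem

variable [P.IsRootSystem]

theorem toWeightBasis_repr_root_eq_simpleCoeff (i : ι) (j : b.support) :
    b.toWeightBasis.repr (P.root i) j = b.simpleCoeff i j := by
  classical
  conv_lhs => rw [b.root_eq_sum_simpleCoeff i]
  simp [Finsupp.single_apply]

variable [P.IsEuclidean]

theorem inner_root_fundamentalCoweight_eq_simpleCoeff (i : ι) (j : b.support) :
    ⟪P.root i, b.fundamentalCoweight j⟫ = b.simpleCoeff i j := by
  classical
  rw [b.inner_root_eq_sum_simpleCoeff]
  simp [inner_root_fundamentalCoweight]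

/-- The coefficient of the fundamental coweight `ϖ_j^∨` in a vector `x` is `(α_j, x)`. -/
theorem eq_sum_inner_smul_fundamentalCoweight (x : V) :
    x = ∑ j : b.support, ⟪P.root j, x⟫ • b.fundamentalCoweight j := by
  classical
  refine InnerProductSpace.ext_inner_left_basis (𝕜 := ℝ) b.toWeightBasis fun i => ?_
  rw [toWeightBasis_apply, inner_sum]
  simp [inner_smul_right, inner_root_fundamentalCoweight]

/-- The sum `ρ^∨` of the fundamental coweights. -/
noncomputable def coweylVector : V := ∑ j, b.fundamentalCoweight j

theorem inner_root_coweylVector (i : ι) : ⟪P.root i, b.coweylVector⟫ = b.height i := by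
  rw [coweylVector, inner_sum, height_eq_sum_simpleCoeff, Int.cast_sum]
  exact Finset.sum_congr rfl fun j _ => b.inner_root_fundamentalCoweight_eq_simpleCoeff i j

theorem fundamentalCoweight_mem_coweightLattice (j : b.support) :
    b.fundamentalCoweight j ∈ P.coweightLattice := fun i =>
  ⟨b.simpleCoeff i j, b.inner_root_fundamentalCoweight_eq_simpleCoeff i j⟩

end RootSystem

end Coeff

end Base

end RootPairing

/-! ### The highest root and the alcove -/

namespace RootPairing.Base

variable {ι V : Type*} [Finite ι] [NormedAddCommGroup V] [InnerProductSpace ℝ V]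
  {P : RootPairing ι ℝ V V} [P.IsRootSystem] [P.IsIrreducible] (b : P.Base)

theorem isPos_highestRootIdx : b.IsPos b.highestRootIdx := by
  have := P.nonempty_of_isIrreducible
  obtain ⟨j, hj⟩ := b.support_nonempty
  have h := b.height_le_height_highestRootIdx j
  rw [height_one_of_mem_support hj] at h
  rw [isPos_iff]
  omega

variable [P.IsCrystallographic]

variable {b} in
omit [P.IsRootSystem] [P.IsIrreducible] in
theorem exists_root_eq_add_of_inner_neg [P.IsEuclidean] {i j : ι} (hj : j ∈ b.support)
    (hi : P.root i ≠ -P.root j) (h : ⟪P.root i, P.root j⟫ < 0) :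
    ∃ k, P.root k = P.root i + P.root j ∧ b.height k = b.height i + 1 := by
  obtain ⟨k, hk⟩ := P.root_add_root_mem_of_pairingIn_neg
    ((P.pairingIn_neg_iff_inner_neg i j).mpr h) hi
  exact ⟨k, hk, by rw [b.height_add hk, height_one_of_mem_support hj]⟩

variable [P.IsEuclidean]

theorem inner_highestRoot_nonneg (j : b.support) : 0 ≤ ⟪b.highestRoot, P.root j⟫ := by
  by_contra! h
  have hne : P.root b.highestRootIdx ≠ -P.root j := by
    intro h
    have h1 := b.inner_root_coweylVector b.highestRootIdx
    rw [h, inner_neg_left, inner_root_coweylVector, height_one_of_mem_support j.2] at h1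
    have h2 := b.isPos_highestRootIdx
    rw [isPos_iff, ← Int.cast_pos (R := ℝ), ← h1] at h2
    norm_num at h2
  obtain ⟨k, -, hk⟩ := exists_root_eq_add_of_inner_neg j.2 hne h
  have := b.height_le_height_highestRootIdx k
  omega

omit [P.IsRootSystem] [P.IsIrreducible] in
theorem inner_simple_nonpos {i j : b.support} (hij : i ≠ j) :
    ⟪P.root i, P.root j⟫ ≤ 0 := by
  have h := b.pairingIn_le_zero_of_ne (fun h => hij (Subtype.ext h)) i.2 j.2
  rwa [← not_lt, pairingIn_pos_iff_inner_pos, not_lt] at h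

variable [P.IsReduced]

/-- Every simple root occurs in the highest root: the simple roots that occur in it are orthogonal
to those that do not, hence span an invariant subspace. -/
theorem simpleCoeff_highestRootIdx_pos (j : b.support) :
    0 < b.simpleCoeff b.highestRootIdx j := by
  set c := b.simpleCoeff b.highestRootIdx
  have hc : ∀ k, 0 ≤ c k := b.isPos_highestRootIdx.simpleCoeff_nonneg
  let s : Set b.support := {k | 0 < c k}
  let q : Submodule ℝ V := Submodule.span ℝ (b.toWeightBasis '' s)
  have hmem : ∀ k, P.root k ∈ q ↔ ∀ l : b.support, b.simpleCoeff k l ≠ 0 → 0 < c l := by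
    intro k
    rw [b.toWeightBasis.mem_span_image]
    simp only [Set.subset_def, Finset.mem_coe, Finsupp.mem_support_iff,
      toWeightBasis_repr_root_eq_simpleCoeff, ne_eq, Int.cast_eq_zero]
    rfl
  -- `(α₀, α_l) ≥ 0`, but it is a sum of nonpositive terms if `α_l` does not occur in `α₀`.
  have horth : ∀ k ∈ s, ∀ l ∉ s, ⟪P.root l, P.root k⟫ = 0 := by
    intro k hk l hl
    have h := b.inner_highestRoot_nonneg l
    rw [highestRoot, inner_root_eq_sum_simpleCoeff] at h
    have hnp : ∀ m ∈ Finset.univ, (c m : ℝ) * ⟪P.root m, P.root l⟫ ≤ 0 := by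
      intro m _
      by_cases hm : m = l
      · have : c m = 0 := le_antisymm (not_lt.mp (hm ▸ hl)) (hc m)
        rw [this, Int.cast_zero, zero_mul]
      · exact mul_nonpos_of_nonneg_of_nonpos (Int.cast_nonneg (hc m)) (b.inner_simple_nonpos hm)
    have h0 := (Finset.sum_eq_zero_iff_of_nonpos hnp).mp (le_antisymm (Finset.sum_nonpos hnp) h) k
      (Finset.mem_univ k)
    rw [real_inner_comm]
    exact (mul_eq_zero.mp h0).resolve_left (Int.cast_ne_zero.mpr (ne_of_gt hk))
  have hinv : ∀ i, q ∈ Module.End.invtSubmodule (P.reflection i : V →ₗ[ℝ] V) := by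
    refine (b.forall_mem_support_invtSubmodule_iff q).mp fun i hi => ?_
    by_cases his : (⟨i, hi⟩ : b.support) ∈ s
    · refine Submodule.mem_invtSubmodule_reflection_of_mem _ _ (Submodule.subset_span ?_)
      exact ⟨⟨i, hi⟩, his, b.toWeightBasis_apply _⟩
    · rw [Module.End.mem_invtSubmodule]
      refine Submodule.span_le.mpr ?_
      rintro _ ⟨k, hk, rfl⟩
      have h0 : P.pairing k i = 0 := by
        have h : ⟪P.root k, P.root i⟫ = 0 :=
          (real_inner_comm _ _).trans (horth k hk ⟨i, hi⟩ his)
        rw [pairing_eq_inner, h, mul_zero]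
      have : P.reflection i (P.root k) = P.root k := by
        rw [reflection_apply_root, h0, zero_smul, sub_zero]
      rw [SetLike.mem_coe, Submodule.mem_comap, toWeightBasis_apply, LinearEquiv.coe_coe, this]
      exact Submodule.subset_span ⟨k, hk, b.toWeightBasis_apply _⟩
  have hθ : P.root b.highestRootIdx ∈ q :=
    (hmem _).mpr fun l hl => lt_of_le_of_ne (hc l) (Ne.symm hl)
  have htop : q = ⊤ := IsIrreducible.eq_top_of_invtSubmodule_reflection (P := P) q hinv
    fun h => P.ne_zero b.highestRootIdx (by rwa [h, Submodule.mem_bot] at hθ)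
  refine (hmem j).mp (htop ▸ Submodule.mem_top) j ?_
  classical
  rw [simpleCoeff_simple, Pi.single_eq_same]
  exact one_ne_zero

/-- The highest root dominates every root coefficientwise. A root of greatest height among
those that violate this would be dominant, hence not orthogonal to the highest root, and the
difference of the two would be a root, positive because of the heights. -/
theorem simpleCoeff_le_simpleCoeff_highestRootIdx (i : ι) (j : b.support) :
    b.simpleCoeff i j ≤ b.simpleCoeff b.highestRootIdx j := by
  revert j
  by_contra hbad
  let S := {i // ¬ ∀ j, b.simpleCoeff i j ≤ b.simpleCoeff b.highestRootIdx j}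
  have : Nonempty S := ⟨⟨i, hbad⟩⟩
  obtain ⟨⟨m, hm⟩, hmax⟩ := Finite.exists_max fun i : S => b.height i
  replace hmax : ∀ k, b.height m < b.height k →
      ∀ j, b.simpleCoeff k j ≤ b.simpleCoeff b.highestRootIdx j := by
    intro k hk
    by_contra hk'
    exact hk.not_ge (hmax ⟨k, hk'⟩)
  have hpos : b.IsPos m := by
    by_contra h
    exact hm fun j => (simpleCoeff_nonpos_of_not_isPos h j).trans
      (b.simpleCoeff_highestRootIdx_pos j).le
  have hdom : ∀ j : b.support, 0 ≤ ⟪P.root j, P.root m⟫ := by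
    intro j
    by_contra! h
    rw [real_inner_comm] at h
    have hne : P.root m ≠ -P.root j := by
      intro h
      have h1 := b.inner_root_coweylVector m
      rw [h, inner_neg_left, inner_root_coweylVector, height_one_of_mem_support j.2] at h1
      rw [isPos_iff, ← Int.cast_pos (R := ℝ), ← h1] at hpos
      norm_num at hpos
    obtain ⟨k, hk, hk'⟩ := exists_root_eq_add_of_inner_neg j.2 hne h
    refine hm fun l => le_trans ?_ (hmax k (by omega) l)
    rw [b.simpleCoeff_add hk]
    exact le_add_of_nonneg_right ((isPos_of_mem_support j.2).simpleCoeff_nonneg l)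
  have hinner : 0 < ⟪P.root b.highestRootIdx, P.root m⟫ := by
    obtain ⟨j, hj, hj'⟩ := hpos.exists_mem_support_pos_pairingIn
    rw [pairingIn_pos_iff_inner_pos] at hj'
    rw [b.inner_root_eq_sum_simpleCoeff]
    refine Finset.sum_pos' (fun k _ => mul_nonneg ?_ (hdom k)) ⟨⟨j, hj⟩, Finset.mem_univ _, ?_⟩
    · exact Int.cast_nonneg (b.simpleCoeff_highestRootIdx_pos k).le
    · exact mul_pos (Int.cast_pos.mpr (b.simpleCoeff_highestRootIdx_pos _)) hj'
  have hne : b.highestRootIdx ≠ m := fun h => hm fun j => by rw [h]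
  obtain ⟨k, hk⟩ := P.root_sub_root_mem_of_pairingIn_pos
    ((P.pairingIn_pos_iff_inner_pos _ _).mpr hinner) hne
  have hkpos : b.IsPos k := by
    rw [isPos_iff', b.height_sub hk]
    exact sub_nonneg.mpr (b.height_le_height_highestRootIdx m)
  refine hm fun j => sub_nonneg.mp ?_
  have := hkpos.simpleCoeff_nonneg j
  rwa [b.simpleCoeff_sub hk] at this

omit [P.IsCrystallographic] [P.IsEuclidean] [P.IsReduced] in
theorem isMinuscule_iff (j : b.support) :
    b.IsMinuscule j ↔ b.simpleCoeff b.highestRootIdx j = 1 := by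
  rw [IsMinuscule, highestRoot, toWeightBasis_repr_root_eq_simpleCoeff, Int.cast_eq_one]

/-- The fundamental alcove in terms of the simple roots and of all roots, without reference to the
highest root. -/
theorem mem_alcove_iff {x : V} :
    x ∈ b.alcove ↔ (∀ α ∈ b.simpleRoots, 0 ≤ ⟪α, x⟫) ∧ ∀ i, ⟪P.root i, x⟫ ≤ 1 := by
  rw [simpleRoots, Set.forall_mem_image]
  refine and_congr_right fun h => ⟨fun hx i => le_trans ?_ hx, fun hx => hx _⟩
  rw [highestRoot, b.inner_root_eq_sum_simpleCoeff, b.inner_root_eq_sum_simpleCoeff]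
  exact Finset.sum_le_sum fun j _ => mul_le_mul_of_nonneg_right
    (Int.cast_le.mpr (b.simpleCoeff_le_simpleCoeff_highestRootIdx i j)) (h j j.2)

omit [P.IsCrystallographic] [P.IsEuclidean] [P.IsReduced] in
variable {b} in
theorem inner_nonpos_of_mem_alcove_of_not_isPos {i : ι} (hi : ¬ b.IsPos i) {x : V}
    (hx : x ∈ b.alcove) : ⟪P.root i, x⟫ ≤ 0 := by
  rw [b.inner_root_eq_sum_simpleCoeff]
  exact Finset.sum_nonpos fun j _ => mul_nonpos_of_nonpos_of_nonneg
    (Int.cast_nonpos.mpr (simpleCoeff_nonpos_of_not_isPos hi j)) (hx.1 j j.2)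

omit [P.IsCrystallographic] [P.IsEuclidean] [P.IsReduced] in
theorem zero_mem_alcove : (0 : V) ∈ b.alcove := by
  simp [alcove]

omit [P.IsCrystallographic] [P.IsReduced] in
/-- The alcove contains a point off all walls through `0`, namely a positive multiple of `ρ^∨`. -/
theorem exists_mem_alcove_forall_inner_pos :
    ∃ x ∈ b.alcove, ∀ i ∈ b.support, 0 < ⟪P.root i, x⟫ := by
  have hpos : (0 : ℝ) < b.height b.highestRootIdx := Int.cast_pos.mpr b.isPos_highestRootIdx
  have h : ∀ i ∈ b.support,
      0 < ⟪P.root i, (b.height b.highestRootIdx : ℝ)⁻¹ • b.coweylVector⟫ := by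
    intro i hi
    rw [inner_smul_right, inner_root_coweylVector, height_one_of_mem_support hi]
    simpa using hpos
  refine ⟨_, ⟨fun i hi => (h i hi).le, ?_⟩, h⟩
  rw [highestRoot, inner_smul_right, inner_root_coweylVector, inv_mul_cancel₀ hpos.ne']

/-- The coweights in the alcove: by the bound `∑ m_j n_j ≤ 1` on its nonnegative integral
coordinates `n_j`, a nonzero one has exactly one nonzero coordinate, with `m_j = n_j = 1`. -/
theorem alcove_inter_coweightLattice :
    b.alcove ∩ P.coweightLattice =
      {0} ∪ Set.range (fun j : {j : b.support // b.IsMinuscule j} => b.fundamentalCoweight j) := by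
  ext x
  simp only [Set.mem_inter_iff, SetLike.mem_coe, Set.singleton_union, Set.mem_insert_iff,
    Set.mem_range]
  constructor
  · classical
    rintro ⟨hx, hxP⟩
    choose n hn using hxP
    have hnn : ∀ j : b.support, 0 ≤ n j := fun j => by
      have := hx.1 j j.2
      rw [hn] at this
      exact_mod_cast this
    have hsum : ∑ j : b.support, b.simpleCoeff b.highestRootIdx j * n j ≤ 1 := by
      have := hx.2
      rw [highestRoot, b.inner_root_eq_sum_simpleCoeff] at this
      simp only [hn] at this
      exact_mod_cast this
    have hxn : x = ∑ j : b.support, (n j : ℝ) • b.fundamentalCoweight j := by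
      conv_lhs => rw [b.eq_sum_inner_smul_fundamentalCoweight x]
      simp only [hn]
    by_cases h0 : ∀ j : b.support, n j = 0
    · left
      rw [hxn]
      exact Finset.sum_eq_zero fun j _ => by rw [h0 j, Int.cast_zero, zero_smul]
    · right
      push Not at h0
      obtain ⟨j, hj⟩ := h0
      have hm := b.simpleCoeff_highestRootIdx_pos
      have hterm : ∀ k ∈ Finset.univ.erase j, 0 ≤ b.simpleCoeff b.highestRootIdx k * n k :=
        fun k _ => mul_nonneg (hm k).le (hnn k)
      rw [← Finset.add_sum_erase _ _ (Finset.mem_univ j)] at hsum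
      have hrest := Finset.sum_nonneg hterm
      have hnj : 0 < n j := lt_of_le_of_ne (hnn j) (Ne.symm hj)
      have hprod : 0 < b.simpleCoeff b.highestRootIdx j * n j := mul_pos (hm j) hnj
      have h1 : b.simpleCoeff b.highestRootIdx j * n j = 1 := by omega
      have hz := (Finset.sum_eq_zero_iff_of_nonneg hterm).mp (by omega)
      have hmj : b.simpleCoeff b.highestRootIdx j = 1 := Int.eq_one_of_mul_eq_one_right (hm j).le h1
      refine ⟨⟨j, (b.isMinuscule_iff j).mpr hmj⟩, ?_⟩
      rw [hmj, one_mul] at h1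
      rw [hxn, Finset.sum_eq_single j (fun k _ hk => ?_) (fun h => absurd (Finset.mem_univ j) h),
        h1, Int.cast_one, one_smul]
      have := hz k (Finset.mem_erase.mpr ⟨hk, Finset.mem_univ k⟩)
      rw [(mul_eq_zero.mp this).resolve_left (hm k).ne', Int.cast_zero, zero_smul]
  · rintro (rfl | ⟨⟨j, hj⟩, rfl⟩)
    · exact ⟨b.zero_mem_alcove, zero_mem _⟩
    · refine ⟨⟨fun i hi => ?_, ?_⟩, b.fundamentalCoweight_mem_coweightLattice j⟩
      · rw [inner_root_fundamentalCoweight_eq_simpleCoeff]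
        exact Int.cast_nonneg ((isPos_of_mem_support hi).simpleCoeff_nonneg j)
      · rw [highestRoot, inner_root_fundamentalCoweight_eq_simpleCoeff,
          (b.isMinuscule_iff j).mp hj, Int.cast_one]

end RootPairing.Base

/-! ### The Weyl group -/

namespace RootPairing

section WeylGroup

variable {ι V : Type*} [NormedAddCommGroup V] [InnerProductSpace ℝ V]
  (P : RootPairing ι ℝ V V)

/-- The orthogonal reflection in the hyperplane perpendicular to a root. -/
noncomputable def orthogonalReflection (i : ι) : V ≃ₗᵢ[ℝ] V := (ℝ ∙ P.root i)ᗮ.reflection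

theorem orthogonalReflection_mem (i : ι) : P.orthogonalReflection i ∈ P.orthogonalWeylGroup :=
  Subgroup.subset_closure ⟨i, rfl⟩

theorem orthogonalReflection_mul_self (i : ι) :
    P.orthogonalReflection i * P.orthogonalReflection i = 1 :=
  Submodule.reflection_mul_reflection _

theorem orthogonalReflection_apply (i : ι) (x : V) :
    P.orthogonalReflection i x =
      x - (2 * (⟪P.root i, x⟫ / ‖P.root i‖ ^ 2)) • P.root i := by
  rw [orthogonalReflection, Submodule.reflection_orthogonal_apply,
    Submodule.reflection_singleton_apply, neg_sub, two_nsmul, ← add_smul, ← two_mul]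
  rfl

variable {P} in
/-- The reflection in the image of a root is the conjugate of the reflection in that root. -/
theorem mul_orthogonalReflection_eq_of_apply_eq {w : V ≃ₗᵢ[ℝ] V} {i j : ι}
    (h : w (P.root i) = P.root j) :
    w * P.orthogonalReflection i = P.orthogonalReflection j * w := by
  ext x
  rw [LinearIsometryEquiv.coe_mul, LinearIsometryEquiv.coe_mul, Function.comp_apply,
    Function.comp_apply, orthogonalReflection_apply, orthogonalReflection_apply, map_sub, map_smul,
    ← h, LinearIsometryEquiv.inner_map_map, LinearIsometryEquiv.norm_map]

variable [P.IsEuclidean]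

theorem orthogonalReflection_root (i j : ι) :
    P.orthogonalReflection i (P.root j) = P.root (P.reflectionPerm i j) :=
  P.orthogonal_reflection_root i j

/-- The reflection in the root `s_j β` is `s_j s_β s_j`. -/
theorem orthogonalReflection_reflectionPerm (i j : ι) :
    P.orthogonalReflection (P.reflectionPerm j i) =
      P.orthogonalReflection j * P.orthogonalReflection i * P.orthogonalReflection j := by
  rw [mul_orthogonalReflection_eq_of_apply_eq (P.orthogonalReflection_root j i), mul_assoc,
    orthogonalReflection_mul_self, mul_one]

variable {P} in
theorem exists_apply_root_eq_root {w : V ≃ₗᵢ[ℝ] V} (hw : w ∈ P.orthogonalWeylGroup) (i : ι) :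
    ∃ j, w (P.root i) = P.root j := by
  revert i
  refine Subgroup.closure_induction_left (p := fun w _ => ∀ i, ∃ j, w (P.root i) = P.root j)
    (fun i => ⟨i, rfl⟩) ?_ ?_ hw
  · rintro _ ⟨k, rfl⟩ y _ ih i
    obtain ⟨j, hj⟩ := ih i
    exact ⟨_, (congrArg (P.orthogonalReflection k) hj).trans (P.orthogonalReflection_root k j)⟩
  · rintro _ ⟨k, rfl⟩ y _ ih i
    obtain ⟨j, hj⟩ := ih i
    rw [Submodule.reflection_inv]
    exact ⟨_, (congrArg (P.orthogonalReflection k) hj).trans (P.orthogonalReflection_root k j)⟩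

theorem finite_orthogonalWeylGroup [Finite ι] [P.IsRootSystem] :
    Finite P.orthogonalWeylGroup := by
  choose f hf using fun w : P.orthogonalWeylGroup => exists_apply_root_eq_root w.2
  refine Finite.of_injective f fun w u h => Subtype.ext <|
    LinearIsometryEquiv.toLinearEquiv_injective <| LinearEquiv.toLinearMap_injective <|
    LinearMap.ext_on
    (IsRootSystem.span_root_eq_top (P := P)) ?_
  rintro _ ⟨i, rfl⟩
  exact (hf w i).trans ((congrArg P.root (congrFun h i)).trans (hf u i).symm)

end WeylGroup

namespace Base

variable {ι V : Type*} [NormedAddCommGroup V] [InnerProductSpace ℝ V]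
  {P : RootPairing ι ℝ V V} [P.IsEuclidean] (b : P.Base)

/-- Every orbit of the Weyl group meets the dominant chamber: an element of the orbit with greatest
inner product with `ρ^∨` is dominant. -/
theorem exists_forall_inner_apply_nonneg [Finite ι] [P.IsRootSystem] (x : V) :
    ∃ w ∈ P.orthogonalWeylGroup, ∀ i ∈ b.support, 0 ≤ ⟪P.root i, w x⟫ := by
  have := P.finite_orthogonalWeylGroup
  obtain ⟨⟨w, hw⟩, hmax⟩ := Finite.exists_max
    fun w : P.orthogonalWeylGroup => ⟪(w : V ≃ₗᵢ[ℝ] V) x, b.coweylVector⟫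
  refine ⟨w, hw, fun i hi => ?_⟩
  have h := hmax ⟨P.orthogonalReflection i * w, mul_mem (P.orthogonalReflection_mem i) hw⟩
  simp only [LinearIsometryEquiv.coe_mul, Function.comp_apply, orthogonalReflection_apply,
    inner_sub_left, real_inner_smul_left, inner_root_coweylVector, height_one_of_mem_support hi,
    Int.cast_one, mul_one, sub_le_self_iff] at h
  have hn : 0 < ‖P.root i‖ ^ 2 := by
    rw [← real_inner_self_eq_norm_sq]
    exact P.inner_root_self_pos i
  have hdiv := nonneg_of_mul_nonneg_right h two_pos
  rwa [le_div_iff₀ hn, zero_mul] at hdiv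

section Words

/-- The product of the simple reflections of a word. -/
noncomputable def wordProd (L : List b.support) : V ≃ₗᵢ[ℝ] V :=
  (L.map fun i => P.orthogonalReflection i).prod

omit [P.IsEuclidean] in
theorem wordProd_mem (L : List b.support) : b.wordProd L ∈ P.orthogonalWeylGroup :=
  list_prod_mem fun w hw => by
    obtain ⟨i, -, rfl⟩ := List.mem_map.mp hw
    exact P.orthogonalReflection_mem i

omit [P.IsEuclidean] in
theorem wordProd_cons (a : b.support) (L : List b.support) :
    b.wordProd (a :: L) = P.orthogonalReflection a * b.wordProd L := by
  simp [wordProd]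

omit [P.IsEuclidean] in
theorem wordProd_append (L M : List b.support) :
    b.wordProd (L ++ M) = b.wordProd L * b.wordProd M := by
  simp [wordProd]

variable [Finite ι] [P.IsCrystallographic] [P.IsReduced]

/-- The Weyl group is generated by the simple reflections. -/
theorem exists_wordProd_eq {w : V ≃ₗᵢ[ℝ] V} (hw : w ∈ P.orthogonalWeylGroup) :
    ∃ L, b.wordProd L = w := by
  have key : ∀ i, ∃ L, b.wordProd L = P.orthogonalReflection i := by
    intro i
    refine b.induction_reflect i (p := fun i => ∃ L, b.wordProd L = P.orthogonalReflection i)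
      ?_ ?_ ?_
    · rintro i ⟨L, hL⟩
      refine ⟨L, ?_⟩
      rw [orthogonalReflection_reflectionPerm, orthogonalReflection_mul_self, one_mul, hL]
    · exact fun i hi => ⟨[⟨i, hi⟩], by simp [wordProd]⟩
    · rintro i j ⟨L, hL⟩ hj
      refine ⟨⟨j, hj⟩ :: L ++ [⟨j, hj⟩], ?_⟩
      rw [wordProd_append, wordProd_cons, hL, orthogonalReflection_reflectionPerm]
      simp [wordProd]
  refine Subgroup.closure_induction_left (p := fun w _ => ∃ L, b.wordProd L = w)
    ⟨[], by simp [wordProd]⟩ ?_ ?_ hw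
  · rintro _ ⟨i, rfl⟩ y _ ⟨M, rfl⟩
    obtain ⟨L, hL⟩ := key i
    exact ⟨L ++ M, by rw [wordProd_append, hL]; rfl⟩
  · rintro _ ⟨i, rfl⟩ y _ ⟨M, rfl⟩
    obtain ⟨L, hL⟩ := key i
    exact ⟨L ++ M, by rw [wordProd_append, hL, Submodule.reflection_inv]; rfl⟩

/-- The exchange condition: if the product of a word sends the simple root `α` to a negative root,
then multiplication by `s_α` on the right deletes a letter of the word. -/
theorem exists_wordProd_eq_mul_of_not_isPos (a : b.support) (L : List b.support) {k : ι}
    (hk : b.wordProd L (P.root a) = P.root k) (hneg : ¬ b.IsPos k) :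
    ∃ M : List b.support, M.length + 1 = L.length ∧
      b.wordProd M = b.wordProd L * P.orthogonalReflection a := by
  induction L generalizing k with
  | nil =>
    have : P.root a = P.root k := by simpa [wordProd] using hk
    exact absurd (isPos_of_mem_support a.2) (P.root.injective this ▸ hneg)
  | cons s T ih =>
    obtain ⟨l, hl⟩ := exists_apply_root_eq_root (b.wordProd_mem T) a
    by_cases hlpos : b.IsPos l
    · refine ⟨T, rfl, ?_⟩
      -- The reflection in the simple root `s` makes no positive root other than `s` negative.
      have hls : l = s := by
        by_contra hne
        refine hneg ?_
        have hk' : P.root k = P.root (P.reflectionPerm s l) := by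
          rw [← hk, wordProd_cons, ← P.orthogonalReflection_root, ← hl]
          rfl
        rw [P.root.injective hk']
        exact hlpos.reflectionPerm s.2 hne
      subst hls
      rw [wordProd_cons, mul_assoc, mul_orthogonalReflection_eq_of_apply_eq hl, ← mul_assoc,
        orthogonalReflection_mul_self, one_mul]
    · obtain ⟨M, hM, hM'⟩ := ih hl hlpos
      exact ⟨s :: M, by simp [hM], by rw [wordProd_cons, wordProd_cons, hM', mul_assoc]⟩

/-- An element of the Weyl group that sends all simple roots to positive roots is trivial: a
shortest word for it ends in a letter that the exchange condition would delete. -/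
theorem eq_one_of_forall_isPos {w : V ≃ₗᵢ[ℝ] V} (hw : w ∈ P.orthogonalWeylGroup)
    (h : ∀ i ∈ b.support, ∀ k, w (P.root i) = P.root k → b.IsPos k) : w = 1 := by
  classical
  let p : ℕ → Prop := fun n => ∃ L, L.length = n ∧ b.wordProd L = w
  have hp : ∃ n, p n := by
    obtain ⟨L, hL⟩ := b.exists_wordProd_eq hw
    exact ⟨_, L, rfl, hL⟩
  obtain ⟨L, hL, hLw⟩ := Nat.find_spec hp
  rcases List.eq_nil_or_concat' L with rfl | ⟨T, a, rfl⟩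
  · rw [← hLw]
    simp [wordProd]
  · exfalso
    have hwT : w = b.wordProd T * P.orthogonalReflection a := by
      rw [← hLw, wordProd_append]
      simp [wordProd]
    obtain ⟨k, hk⟩ := exists_apply_root_eq_root (b.wordProd_mem T) a
    -- The last letter `a` changes the sign of its root, so the rest of the word makes it negative.
    have hneg : ¬ b.IsPos k := by
      have h1 := h a a.2 (P.reflectionPerm k k) <| by
        rw [hwT, LinearIsometryEquiv.coe_mul, Function.comp_apply, orthogonalReflection_root,
          root_reflectionPerm, root_reflectionPerm, reflection_apply_self, reflection_apply_self,
          map_neg, hk]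
      let _ := P.indexNeg
      exact (IsPos.neg_iff_not b k).mp h1
    obtain ⟨M, hM, hM'⟩ := b.exists_wordProd_eq_mul_of_not_isPos a T hk hneg
    have hlen := Nat.find_min' hp ⟨M, rfl, hM'.trans hwT.symm⟩
    simp only [List.length_append, List.length_singleton] at hL
    omega

end Words

end Base

end RootPairing

/-! ### The elements exchanging a minuscule root -/

namespace RootPairing.Base

variable {ι V : Type*} [Finite ι] [NormedAddCommGroup V] [InnerProductSpace ℝ V]
  {P : RootPairing ι ℝ V V} [P.IsRootSystem] [P.IsCrystallographic] [P.IsReduced]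
  [P.IsEuclidean] (b : P.Base)

omit [P.IsRootSystem] in
theorem eq_one_of_image_simpleRoots_eq {w : V ≃ₗᵢ[ℝ] V} (hw : w ∈ P.orthogonalWeylGroup)
    (h : w '' b.simpleRoots = b.simpleRoots) : w = 1 := by
  refine b.eq_one_of_forall_isPos hw fun i hi k hk => ?_
  obtain ⟨j, hj, hjk⟩ : P.root k ∈ b.simpleRoots := by
    rw [← hk, ← h]
    exact Set.mem_image_of_mem w (Set.mem_image_of_mem _ hi)
  exact P.root.injective hjk ▸ isPos_of_mem_support hj

omit [P.IsRootSystem] in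
theorem eq_of_image_simpleRoots_eq {w u : V ≃ₗᵢ[ℝ] V} (hw : w ∈ P.orthogonalWeylGroup)
    (hu : u ∈ P.orthogonalWeylGroup) (h : w '' b.simpleRoots = u '' b.simpleRoots) : w = u := by
  refine (inv_mul_eq_one.mp (b.eq_one_of_image_simpleRoots_eq (mul_mem (inv_mem hu) hw) ?_)).symm
  rw [LinearIsometryEquiv.coe_mul, Set.image_comp, h, ← Set.image_comp,
    ← LinearIsometryEquiv.coe_mul, inv_mul_cancel, LinearIsometryEquiv.coe_one, Set.image_id]

/-- The image of a system of simple roots under the Weyl group is a system of simple roots. -/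
theorem exists_simpleRoots_eq_image {w : V ≃ₗᵢ[ℝ] V} (hw : w ∈ P.orthogonalWeylGroup) :
    ∃ b' : P.Base, b'.simpleRoots = w '' b.simpleRoots := by
  choose f hf using exists_apply_root_eq_root hw
  have himage : P.root '' (f '' b.support) = w '' (P.root '' b.support) := by
    rw [Set.image_image, Set.image_image]
    simp only [hf]
  have hcomp : P.root ∘ f = w ∘ P.root := funext fun i => (hf i).symm
  have hclosure : ∀ x ∈ AddSubmonoid.closure (P.root '' b.support),
      w x ∈ AddSubmonoid.closure (P.root '' (f '' b.support)) := by
    intro x hx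
    rw [himage]
    have := AddSubmonoid.mem_map_of_mem (w.toLinearEquiv : V →+ V) hx
    rwa [AddMonoidHom.map_mclosure] at this
  have hli : LinearIndepOn ℝ P.root (f '' b.support) := by
    refine LinearIndepOn.image_of_comp f P.root ?_
    rw [hcomp]
    exact b.linearIndepOn_root.map_injOn (w.toLinearEquiv : V →ₗ[ℝ] V) w.injective.injOn
  have hmem : ∀ i, P.root i ∈ AddSubmonoid.closure (P.root '' (f '' b.support)) ∨
      -P.root i ∈ AddSubmonoid.closure (P.root '' (f '' b.support)) := by
    intro i
    obtain ⟨k, hk⟩ := exists_apply_root_eq_root (inv_mem hw) i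
    have hik : P.root i = w (P.root k) := by
      rw [← hk]
      exact (w.apply_symm_apply _).symm
    rw [hik, ← map_neg]
    exact (b.root_mem_or_neg_mem k).imp (hclosure _) (hclosure _)
  refine ⟨Base.mk' P (f '' b.support) hli hmem, ?_⟩
  rw [simpleRoots, simpleRoots, ← himage]
  simp [Base.mk']

variable [P.IsIrreducible]

theorem eq_one_of_image_alcove_eq {w : V ≃ₗᵢ[ℝ] V} (hw : w ∈ P.orthogonalWeylGroup)
    (h : w '' b.alcove = b.alcove) : w = 1 := by
  refine b.eq_one_of_forall_isPos hw fun i hi k hk => ?_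
  obtain ⟨x, hx, hpos⟩ := b.exists_mem_alcove_forall_inner_pos
  by_contra hneg
  have h1 := inner_nonpos_of_mem_alcove_of_not_isPos hneg (h ▸ Set.mem_image_of_mem w hx)
  rw [← hk, LinearIsometryEquiv.inner_map_map] at h1
  exact (hpos i hi).not_ge h1

theorem alcove_eq_image {b' : P.Base} {w : V ≃ₗᵢ[ℝ] V} (hw : w ∈ P.orthogonalWeylGroup)
    (h : b'.simpleRoots = w '' b.simpleRoots) : b'.alcove = w '' b.alcove := by
  have hinner : ∀ α x : V, ⟪w α, x⟫ = ⟪α, w.symm x⟫ := fun α x => by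
    rw [← w.inner_map_map α, w.apply_symm_apply]
  ext x
  rw [LinearIsometryEquiv.image_eq_preimage_symm, Set.mem_preimage, mem_alcove_iff, mem_alcove_iff,
    h, Set.forall_mem_image]
  simp only [hinner]
  refine and_congr_right fun _ => ⟨fun hx i => ?_, fun hx i => ?_⟩
  · obtain ⟨k, hk⟩ := exists_apply_root_eq_root hw i
    rw [← hinner, hk]
    exact hx k
  · obtain ⟨k, hk⟩ := exists_apply_root_eq_root (inv_mem hw) i
    have hik : P.root i = w (P.root k) := by
      rw [← hk]
      exact (w.apply_symm_apply _).symm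
    rw [hik, hinner]
    exact hx k

omit [P.IsCrystallographic] [P.IsReduced] in
theorem ncard_exchangedRoots (j : b.support) : (b.exchangedRoots j).ncard = b.support.card := by
  have hinj : Function.Injective fun i : b.support => P.root i :=
    P.root.injective.comp Subtype.val_injective
  rw [exchangedRoots, Set.ncard_insert_of_notMem, Set.ncard_image_of_injective _ hinj]
  · have : {i | i ≠ j} = Set.univ \ {j} := by ext i; simp
    rw [this, Set.ncard_sdiff_singleton_add_one (Set.mem_univ j), Set.ncard_univ,
      Nat.card_eq_fintype_card, Fintype.card_coe]
  · rintro ⟨i, -, hi⟩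
    have h1 := congrArg (fun x => ⟪x, b.coweylVector⟫) hi
    simp only [highestRoot, inner_neg_left, inner_root_coweylVector,
      height_one_of_mem_support i.2] at h1
    have h2 : (0 : ℝ) < b.height b.highestRootIdx := Int.cast_pos.mpr b.isPos_highestRootIdx
    push_cast at h1
    linarith

/-- The vector `ρ^∨ - (ht α₀ + 1) ϖ_j^∨` is regular and takes integral values on the roots. Its
value is `1` on each root of `Π_j`, so `Π_j` consists of the roots that are simple for the chamber
of this vector. -/
theorem exists_image_simpleRoots_eq_exchangedRoots {j : b.support} (hj : b.IsMinuscule j) :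
    ∃ v ∈ P.orthogonalWeylGroup, v '' b.simpleRoots = b.exchangedRoots j := by
  rw [isMinuscule_iff] at hj
  set h : ℤ := b.height b.highestRootIdx + 1
  let y : V := b.coweylVector - (h : ℝ) • b.fundamentalCoweight j
  have hy : ∀ i, ⟪P.root i, y⟫ = ((b.height i - h * b.simpleCoeff i j : ℤ) : ℝ) := by
    intro i
    rw [inner_sub_right, inner_smul_right, inner_root_coweylVector,
      inner_root_fundamentalCoweight_eq_simpleCoeff]
    push_cast
    rfl
  -- On a positive root `y` is the height or the height minus `ht α₀ + 1`, as `m_j = 1`.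
  have hpos0 : ∀ i, b.IsPos i → b.height i - h * b.simpleCoeff i j ≠ 0 := by
    intro i hi
    have h1 := b.isPos_iff.mp hi
    have h2 := b.height_le_height_highestRootIdx i
    have h3 := hi.simpleCoeff_nonneg j
    have h4 := b.simpleCoeff_le_simpleCoeff_highestRootIdx i j
    rw [hj] at h4
    obtain h0 | h0 : b.simpleCoeff i j = 0 ∨ b.simpleCoeff i j = 1 := by omega
    · rw [h0]; omega
    · rw [h0]; omega
  have hreg : ∀ i, ⟪P.root i, y⟫ ≠ 0 := by
    intro i
    let _ := P.indexNeg
    rcases IsPos.or_neg b i with hi | hi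
    · rw [hy, Int.cast_ne_zero]
      exact hpos0 i hi
    · have h1 : ⟪P.root (-i), y⟫ ≠ 0 := by
        rw [hy, Int.cast_ne_zero]
        exact hpos0 (-i) hi
      intro h0
      refine h1 ?_
      rw [indexNeg_neg, root_reflectionPerm, reflection_apply_self, inner_neg_left, h0, neg_zero]
  obtain ⟨w, hw, hdom⟩ := b.exists_forall_inner_apply_nonneg y
  have hinner : ∀ α x : V, ⟪α, w x⟫ = ⟪w.symm α, x⟫ := fun α x => by
    rw [← w.inner_map_map (w.symm α), w.apply_symm_apply]
  have hge : ∀ a : b.support, 1 ≤ ⟪P.root a, w y⟫ := by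
    intro a
    have h0 := hdom a a.2
    obtain ⟨k, hk⟩ := exists_apply_root_eq_root (inv_mem hw) a
    replace hk : w.symm (P.root a) = P.root k := hk
    have hne := hreg k
    rw [hinner, hk, hy] at h0 ⊢
    rw [hy] at hne
    have h1 : 0 ≤ b.height k - h * b.simpleCoeff k j := Int.cast_nonneg_iff.mp h0
    have h2 : b.height k - h * b.simpleCoeff k j ≠ 0 := Int.cast_ne_zero.mp hne
    exact_mod_cast (by omega : 1 ≤ b.height k - h * b.simpleCoeff k j)
  -- The value at a positive root is a sum of `ht` many terms, each at least `1`.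
  have hone : ∀ k, ⟪P.root k, w y⟫ = 1 → k ∈ b.support := by
    intro k hk
    have hsum := b.inner_root_eq_sum_simpleCoeff k (w y)
    rw [hk] at hsum
    have hkpos : b.IsPos k := by
      by_contra hneg
      have : ∑ a, (b.simpleCoeff k a : ℝ) * ⟪P.root a, w y⟫ ≤ 0 :=
        Finset.sum_nonpos fun a _ => mul_nonpos_of_nonpos_of_nonneg
          (Int.cast_nonpos.mpr (simpleCoeff_nonpos_of_not_isPos hneg a)) (hdom a a.2)
      linarith
    refine hkpos.mem_support_of_height_le_one ?_
    rw [← Int.cast_le (R := ℝ), Int.cast_one, hsum, height_eq_sum_simpleCoeff, Int.cast_sum]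
    exact Finset.sum_le_sum fun a _ =>
      le_mul_of_one_le_right (Int.cast_nonneg (hkpos.simpleCoeff_nonneg a)) (hge a)
  have hval : ∀ α ∈ b.exchangedRoots j, ⟪α, y⟫ = 1 := by
    classical
    rintro α (rfl | ⟨i, hij, rfl⟩)
    · rw [inner_neg_left, highestRoot, hy, hj, ← Int.cast_neg]
      simp [h]
    · have : b.simpleCoeff i j = 0 := by
        rw [simpleCoeff_simple, Pi.single_eq_of_ne (Ne.symm hij)]
      simp [hy, this, height_one_of_mem_support i.2]
  have hroot : ∀ α ∈ b.exchangedRoots j, ∃ i, P.root i = α := by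
    rintro α (rfl | ⟨i, -, rfl⟩)
    · exact ⟨P.reflectionPerm b.highestRootIdx b.highestRootIdx, by
        rw [root_reflectionPerm, reflection_apply_self, highestRoot]⟩
    · exact ⟨i, rfl⟩
  refine ⟨w⁻¹, inv_mem hw, (Set.eq_of_subset_of_ncard_le (fun α hα => ?_) ?_
    ((b.support.finite_toSet.image _).image _)).symm⟩
  · obtain ⟨i, rfl⟩ := hroot α hα
    obtain ⟨k, hk⟩ := exists_apply_root_eq_root hw i
    refine ⟨P.root k, ⟨k, hone k ?_, rfl⟩, ?_⟩
    · rw [← hk, LinearIsometryEquiv.inner_map_map, hval _ hα]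
    · rw [← hk]
      exact w.symm_apply_apply _
  · rw [ncard_exchangedRoots, Set.ncard_image_of_injective _ (w⁻¹).injective,
      Set.ncard_image_of_injective _ P.root.injective, Set.ncard_coe_finset]

/-- The alcove of `Π_j` is a translate of the fundamental alcove: a root of `Φ` has coefficient
`-1`, `0` or `1` at the minuscule root `α_j`, and the roots take values of absolute value at most
`1` on the alcove. -/
theorem image_alcove_eq_image_sub_fundamentalCoweight {j : b.support} (hj : b.IsMinuscule j)
    {v : V ≃ₗᵢ[ℝ] V} (hv : v ∈ P.orthogonalWeylGroup)
    (hvj : v '' b.simpleRoots = b.exchangedRoots j) :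
    v '' b.alcove = (fun x => x - b.fundamentalCoweight j) '' b.alcove := by
  classical
  rw [isMinuscule_iff] at hj
  obtain ⟨b', hb'⟩ := b.exists_simpleRoots_eq_image hv
  rw [← b.alcove_eq_image hv hb']
  have hsimple : ∀ i : b.support, ⟪P.root i, b.fundamentalCoweight j⟫ = if i = j then 1 else 0 :=
    fun i => by rw [inner_root_fundamentalCoweight]
  have hθ : ⟪b.highestRoot, b.fundamentalCoweight j⟫ = 1 := by
    rw [highestRoot, inner_root_fundamentalCoweight_eq_simpleCoeff, hj, Int.cast_one]
  ext x
  have htrans : x ∈ (fun x => x - b.fundamentalCoweight j) '' b.alcove ↔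
      x + b.fundamentalCoweight j ∈ b.alcove := by
    simp [Set.mem_image, sub_eq_iff_eq_add]
  rw [htrans, mem_alcove_iff, hb', hvj]
  constructor
  · rintro ⟨h0, h1⟩
    refine ⟨fun i hi => ?_, ?_⟩
    · rw [inner_add_right, hsimple ⟨i, hi⟩]
      split_ifs with hij
      -- For `i = j` the bound is the inequality of the root `-α_j`.
      · have := h1 (P.reflectionPerm i i)
        rw [root_reflectionPerm, reflection_apply_self, inner_neg_left] at this
        linarith
      · rw [add_zero]
        exact h0 _ (Or.inr ⟨⟨i, hi⟩, hij, rfl⟩)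
    · have := h0 _ (Or.inl rfl)
      rw [inner_neg_left] at this
      rw [inner_add_right, hθ]
      linarith
  · intro hx
    refine ⟨?_, fun i => ?_⟩
    · rintro α (rfl | ⟨i, hij, rfl⟩)
      · have := hx.2
        rw [inner_add_right, hθ] at this
        rw [inner_neg_left]
        linarith
      · have := hx.1 i i.2
        rwa [inner_add_right, hsimple, if_neg hij, add_zero] at this
    · have hle := (b.mem_alcove_iff.mp hx).2 i
      rw [inner_add_right, inner_root_fundamentalCoweight_eq_simpleCoeff] at hle
      by_cases hi : b.IsPos i
      · have : (0 : ℝ) ≤ b.simpleCoeff i j := Int.cast_nonneg (hi.simpleCoeff_nonneg j)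
        linarith
      · have h0 := inner_nonpos_of_mem_alcove_of_not_isPos hi hx
        rw [inner_add_right, inner_root_fundamentalCoweight_eq_simpleCoeff] at h0
        have hneg : -1 ≤ b.simpleCoeff i j := by
          let _ := P.indexNeg
          have h1 := b.simpleCoeff_le_simpleCoeff_highestRootIdx (-i) j
          have h2 : b.simpleCoeff (-i) j = - b.simpleCoeff i j := by
            rw [← Int.cast_inj (α := ℝ), ← inner_root_fundamentalCoweight_eq_simpleCoeff,
              indexNeg_neg, root_reflectionPerm, reflection_apply_self, inner_neg_left,
              inner_root_fundamentalCoweight_eq_simpleCoeff, Int.cast_neg]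
          omega
        have : (-1 : ℝ) ≤ b.simpleCoeff i j := by exact_mod_cast hneg
        linarith

/-! ### The fundamental group -/

omit [P.IsCrystallographic] [P.IsReduced] in
theorem apply_mem_alcove_inter_coweightLattice {ζ : V ≃ᵃⁱ[ℝ] V} (hζ : ζ ∈ b.fundamentalGroup)
    {x : V} (hx : x ∈ b.alcove ∩ P.coweightLattice) :
    ζ x ∈ b.alcove ∩ P.coweightLattice := by
  obtain ⟨⟨γ, hγ, w, hw, rfl⟩, hA⟩ := hζ
  refine ⟨hA ▸ Set.mem_image_of_mem _ hx.1, ?_⟩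
  simpa using add_mem hγ (P.orthogonalWeylGroup_apply_mem_coweightLattice hw x hx.2)

/-- The stabilizer of the vertex `0` in the fundamental group is trivial: it consists of elements of
the Weyl group that preserve the alcove. -/
theorem eq_one_of_mem_fundamentalGroup_of_apply_zero {ζ : V ≃ᵃⁱ[ℝ] V}
    (hζ : ζ ∈ b.fundamentalGroup) (h0 : ζ 0 = 0) : ζ = 1 := by
  obtain ⟨⟨γ, hγ, w, hw, rfl⟩, hA⟩ := hζ
  have hγ0 : γ = 0 := by simpa using h0
  subst hγ0
  have hw1 : w = 1 := b.eq_one_of_image_alcove_eq hw <| by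
    conv_rhs => rw [← hA]
    exact Set.image_congr fun x _ => by simp
  subst hw1
  ext x
  simp

theorem eq_of_mem_fundamentalGroup_of_apply_zero_eq {ζ η : V ≃ᵃⁱ[ℝ] V}
    (hζ : ζ ∈ b.fundamentalGroup) (hη : η ∈ b.fundamentalGroup) (h : ζ 0 = η 0) : ζ = η := by
  refine (inv_mul_eq_one.mp (b.eq_one_of_mem_fundamentalGroup_of_apply_zero
    (mul_mem (inv_mem hη) hζ) ?_)).symm
  rw [AffineIsometryEquiv.coe_mul, Function.comp_apply, h]
  exact η.symm_apply_apply 0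

omit [P.IsCrystallographic] [P.IsReduced] in
theorem constVAdd_mul_mem_fundamentalGroup {j : b.support} {v : V ≃ₗᵢ[ℝ] V}
    (hv : v ∈ P.orthogonalWeylGroup)
    (h : v '' b.alcove = (fun x => x - b.fundamentalCoweight j) '' b.alcove) :
    AffineIsometryEquiv.constVAdd ℝ V (b.fundamentalCoweight j) * v.toAffineIsometryEquiv ∈
      b.fundamentalGroup := by
  refine ⟨⟨_, b.fundamentalCoweight_mem_coweightLattice j, v, hv, rfl⟩, ?_⟩
  rw [AffineIsometryEquiv.coe_mul, Set.image_comp, LinearIsometryEquiv.coe_toAffineIsometryEquiv, h,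
    Set.image_image]
  simp

/-- Simple transitivity follows from the transitivity assumed here, since an element of the
fundamental group is determined by the image of `0`. -/
theorem existsUnique_mem_fundamentalGroup
    (htrans : ∀ x ∈ b.alcove ∩ P.coweightLattice, ∃ ζ ∈ b.fundamentalGroup, ζ 0 = x)
    {x y : V} (hx : x ∈ b.alcove ∩ P.coweightLattice) (hy : y ∈ b.alcove ∩ P.coweightLattice) :
    ∃! ζ, ζ ∈ b.fundamentalGroup ∧ ζ x = y := by
  obtain ⟨ξ, hξ, rfl⟩ := htrans x hx
  obtain ⟨η, hη, rfl⟩ := htrans y hy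
  refine ⟨η * ξ⁻¹, ⟨mul_mem hη (inv_mem hξ), congrArg η (ξ.symm_apply_apply 0)⟩, ?_⟩
  rintro ζ ⟨hζ, hζξ⟩
  exact eq_mul_inv_of_mul_eq
    (b.eq_of_mem_fundamentalGroup_of_apply_zero_eq (mul_mem hζ hξ) hη hζξ)

end RootPairing.Base

theorem mainTheorem4 {ι V : Type*} [Finite ι]
    [NormedAddCommGroup V] [InnerProductSpace ℝ V] [FiniteDimensional ℝ V]
    (P : RootPairing ι ℝ V V) [P.IsRootSystem] [P.IsCrystallographic] [P.IsReduced]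
    [P.IsIrreducible] [P.IsEuclidean] (b : P.Base) :
    ∃ v : {j : b.support // b.IsMinuscule j} → (V ≃ₗᵢ[ℝ] V),
      -- `v j` is the unique element of `W` with `v j Π = Π_j`
      (∀ j : {j : b.support // b.IsMinuscule j},
        v j ∈ P.orthogonalWeylGroup ∧ v j '' b.simpleRoots = b.exchangedRoots j ∧
        ∀ w ∈ P.orthogonalWeylGroup, w '' b.simpleRoots = b.exchangedRoots j → w = v j) ∧
      -- `Π_j` is a system of simple roots, and its fundamental alcove is `v j 𝓐 = 𝓐 - ϖ_j^∨`
      (∀ j : {j : b.support // b.IsMinuscule j},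
        (∃ b' : P.Base, b'.simpleRoots = b.exchangedRoots j) ∧
        (∀ b' : P.Base, b'.simpleRoots = b.exchangedRoots j → b'.alcove = v j '' b.alcove) ∧
        v j '' b.alcove = (fun x => x - b.fundamentalCoweight j) '' b.alcove) ∧
      -- `Ω = {1} ∪ {t_{ϖ_j^∨} v_j}`
      (b.fundamentalGroup : Set (V ≃ᵃⁱ[ℝ] V)) =
        {1} ∪ Set.range (fun j : {j : b.support // b.IsMinuscule j} =>
          AffineIsometryEquiv.constVAdd ℝ V (b.fundamentalCoweight j) *
            (v j).toAffineIsometryEquiv) ∧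
      -- the minuscule vertices
      b.alcove ∩ P.coweightLattice =
        {0} ∪ Set.range (fun j : {j : b.support // b.IsMinuscule j} =>
          b.fundamentalCoweight j) ∧
      -- `Ω` acts on the minuscule vertices, simply transitively
      (∀ ζ ∈ b.fundamentalGroup, ∀ x ∈ b.alcove ∩ P.coweightLattice,
        ζ x ∈ b.alcove ∩ P.coweightLattice) ∧
      (∀ x ∈ b.alcove ∩ P.coweightLattice, ∀ y ∈ b.alcove ∩ P.coweightLattice,
        ∃! ζ, ζ ∈ b.fundamentalGroup ∧ ζ x = y) := by
  classical
  have hex : ∀ j : {j : b.support // b.IsMinuscule j}, ∃ v ∈ P.orthogonalWeylGroup,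
      v '' b.simpleRoots = b.exchangedRoots j :=
    fun j => b.exists_image_simpleRoots_eq_exchangedRoots j.2
  choose v hvW hv using hex
  have hvA : ∀ j, v j '' b.alcove = (fun x => x - b.fundamentalCoweight j) '' b.alcove :=
    fun j => b.image_alcove_eq_image_sub_fundamentalCoweight j.2 (hvW j) (hv j)
  have hΩ : ∀ j : {j : b.support // b.IsMinuscule j},
      AffineIsometryEquiv.constVAdd ℝ V (b.fundamentalCoweight j) * (v j).toAffineIsometryEquiv ∈
        b.fundamentalGroup :=
    fun j => b.constVAdd_mul_mem_fundamentalGroup (hvW j) (hvA j)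
  have hzero : ∀ j : {j : b.support // b.IsMinuscule j},
      (AffineIsometryEquiv.constVAdd ℝ V (b.fundamentalCoweight j) *
        (v j).toAffineIsometryEquiv) 0 = b.fundamentalCoweight j := fun j => by simp
  have hvertices := b.alcove_inter_coweightLattice
  refine ⟨v, fun j => ⟨hvW j, hv j, fun w hw h => ?_⟩, fun j => ⟨?_, fun b' hb' => ?_, hvA j⟩,
    ?_, hvertices, fun ζ hζ x hx => b.apply_mem_alcove_inter_coweightLattice hζ hx,
    fun x hx y hy => b.existsUnique_mem_fundamentalGroup (fun x hx => ?_) hx hy⟩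
  · exact b.eq_of_image_simpleRoots_eq hw (hvW j) (h.trans (hv j).symm)
  · rw [← hv j]
    exact b.exists_simpleRoots_eq_image (hvW j)
  · exact b.alcove_eq_image (hvW j) (hb'.trans (hv j).symm)
  · refine Set.Subset.antisymm (fun ζ hζ => ?_) ?_
    · have h0 := b.apply_mem_alcove_inter_coweightLattice hζ ⟨b.zero_mem_alcove, zero_mem _⟩
      rw [hvertices] at h0
      obtain h0 | ⟨j, hj⟩ := h0
      · exact Or.inl (b.eq_one_of_mem_fundamentalGroup_of_apply_zero hζ h0)
      · exact Or.inr ⟨j, b.eq_of_mem_fundamentalGroup_of_apply_zero_eq (hΩ j) hζ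
          ((hzero j).trans hj)⟩
    · rintro ζ (rfl | ⟨j, rfl⟩)
      · exact one_mem b.fundamentalGroup
      · exact hΩ j
  · rw [hvertices] at hx
    obtain rfl | ⟨j, rfl⟩ := hx
    · exact ⟨1, one_mem _, rfl⟩
    · exact ⟨_, hΩ j, hzero j⟩
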